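/- **Theorem (Plancherel theorem for the continuous wavelet transform on a local field).** Let $\mathbb{K}$ be a non-archimedean local field, $dx$ a Haar measure on its additive group, and $|\cdot|$ its absolute value, normalised by $d(\alpha x)=|\alpha|\,dx$ for $\alpha\neq 0$ and $|0|=0$. Let $\mathfrak{D}$ be the ring of integers of $\mathbb{K}$, $\mathfrak{P}$ its prime ideal, and let $\chi$ be a continuous unitary character of the additive group of $\mathbb{K}$ that is trivial on $\mathfrak{D}$ but not on $\mathfrak{P}^{-1}$. Let $\hat f$ denote the Fourier transform of $f\in L^2(\mathbb{K})$, that is, the extension to $L^2(\mathbb{K})$ by continuity of $\hat f(\xi)=\int_{\mathbb{K}} f(x)\chi(-\xi x)\,dx$, $f\in L^1(\mathbb{K})\cap L^2(\mathbb{K})$. Let $\psi\in L^2(\mathbb{K})$ be an admissible wavelet, i.e. $$c_\psi=\int_{\mathbb{K}}\frac{|\hat\psi(\xi)|^2}{|\xi|}\,d\xi<\infty ,$$ and for $f\in L^2(\mathbb{K})$, $a,b\in\mathbb{K}$, $a\ne 0$, put $$(K_\psi f)(a,b)=\int_{\mathbb{K}} f(x)\,\overline{\psi_{a,b}(x)}\,dx,\qquad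 \psi_{a,b}(x)=|a|^{-1/2}\,\psi\!\left(\frac{x-b}{a}\right).$$ Then for all $f,g\in L^2(\mathbb{K})$ the functions $K_\psi f$ and $K_\psi g$ belong to $L^2\big(\mathbb{K}\times\mathbb{K},\,|a|^{-2}\,da\,db\big)$ and $$\int_{\mathbb{K}\times\mathbb{K}} (K_\psi f)(a,b)\,\overline{(K_\psi g)(a,b)}\,\frac{da\,db}{|a|^2}=c_\psi\int_{\mathbb{K}} f(x)\,\overline{g(x)}\,dx .$$ In particular (with $f=g$) $$\int_{\mathbb{K}\times\mathbb{K}} |(K_\psi f)(a,b)|^2\,\frac{da\,db}{|a|^2}=c_\psi\,\|f\|_{L^2(\mathbb{K})}^2 ,$$ so $K_\psi$ is an isometry up to the constant factor $c_\psi$. -/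

import Mathlib

open MeasureTheory Filter Topology ValuativeRel
open scoped NNReal ENNReal ComplexConjugate

namespace LocalFieldCWT

noncomputable section

section AbsoluteValue

variable {K : Type*} [Field K] [ValuativeRel K] [TopologicalSpace K]
  [IsNonarchimedeanLocalField K] [MeasurableSpace K] [BorelSpace K]

open Classical in
/-- The absolute value of a local field: `|0| = 0`, and for `x ≠ 0` it is the factor by which
multiplication by `x` scales additive Haar measure, `d(x y) = |x| dy`. -/
def absK (x : K) : ℝ≥0 :=
  if h : x = 0 then 0 else distribHaarChar K (Units.mk0 x h)

/-- The daughter wavelet `ψ_{a,b}(x) = |a|^{-1/2} ψ((x - b) / a)` (meaningful for `a ≠ 0`). -/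
def daughter (ψ : K → ℂ) (a b : K) (x : K) : ℂ :=
  (((Real.sqrt (absK a))⁻¹ : ℝ) : ℂ) * ψ ((x - b) / a)

/-- The continuous wavelet transform
`(K_ψ f)(a, b) = (f, ψ_{a,b}) = ∫ f(x) conj (ψ_{a,b}(x)) dx`. -/
def cwt (μ : Measure K) (ψ f : K → ℂ) (p : K × K) : ℂ :=
  ∫ x, f x * conj (daughter ψ p.1 p.2 x) ∂μ

/-- The measure `da db / |a|²` on `K × K` (the slice `a = 0` is a null set). -/
def cwtMeasure (μ : Measure K) : Measure (K × K) :=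
  (μ.prod μ).withDensity fun p => (((absK p.1 ^ 2)⁻¹ : ℝ≥0) : ℝ≥0∞)

/-- `χ` is a continuous unitary character of the additive group of `K` that is trivial on the ring
of integers `𝒪[K]` and nontrivial on the inverse `{x | x 𝓂[K] ⊆ 𝒪[K]}` of the prime ideal. -/
structure IsBasicCharacter (χ : AddChar K Circle) : Prop where
  continuous : Continuous χ
  trivial_on_integers : ∀ x ∈ 𝒪[K], χ x = 1
  nontrivial_on_inverse :
    ∃ x : K, (∀ y : 𝒪[K], y ∈ 𝓂[K] → x * (y : K) ∈ 𝒪[K]) ∧ χ x ≠ 1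

/-- `F` represents the `L²` Fourier transform of `f ∈ L²`: it is an `L²` limit of the Fourier
integrals `ξ ↦ ∫ u_n(x) χ(-ξ x) dx` of some functions `u_n ∈ L¹ ∩ L²` that tend to `f` in `L²`. -/
def IsL2Fourier (χ : AddChar K Circle) (μ : Measure K) (f F : K → ℂ) : Prop :=
  MemLp F 2 μ ∧ ∃ u : ℕ → K → ℂ,
    (∀ n, Integrable (u n) μ ∧ MemLp (u n) 2 μ) ∧
    Tendsto (fun n => eLpNorm (u n - f) 2 μ) atTop (𝓝 0) ∧
    Tendsto (fun n => eLpNorm (Fourier.fourierIntegral χ μ (u n) - F) 2 μ) atTop (𝓝 0)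

/-- The Fourier transform on `L²`. By Plancherel's theorem each `f ∈ L²` has a Fourier transform
in the sense of `IsL2Fourier`, unique up to equality almost everywhere; this is a representative. -/
def fourierL2 (χ : AddChar K Circle) (μ : Measure K) (f : K → ℂ) : K → ℂ :=
  Classical.epsilon (IsL2Fourier χ μ f)

/-- The constant `c_ψ = ∫ |ψ̂(ξ)|² / |ξ| dξ ∈ [0, ∞]`. -/
def admissibilityConst (χ : AddChar K Circle) (μ : Measure K) (ψ : K → ℂ) : ℝ≥0∞ :=
  ∫⁻ ξ, ‖fourierL2 χ μ ψ ξ‖ₑ ^ 2 / (absK ξ : ℝ≥0∞) ∂μ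

/-- `ψ` is an admissible wavelet: `ψ ∈ L²` and `c_ψ < ∞`. -/
def IsAdmissible (χ : AddChar K Circle) (μ : Measure K) (ψ : K → ℂ) : Prop :=
  MemLp ψ 2 μ ∧ admissibilityConst χ μ ψ < ∞

end AbsoluteValue

/-- The `L²` inner product `(f, g) = ∫ f conj g`, linear in the first argument. -/
def l2Inner {X : Type*} [MeasurableSpace X] (μ : Measure X) (f g : X → ℂ) : ℂ :=
  ∫ x, f x * conj (g x) ∂μ

end

end LocalFieldCWT

/-!
Plancherel's theorem on `K`: for `f ∈ L¹ ∩ L²`, `|f̂|²` is the Fourier transform of the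
autocorrelation of `f`, which is continuous with value `‖f‖²` at `0`. The indicator of a ball
`c 𝒪` has as Fourier transform `μ (c 𝒪)` times the indicator of the dual ball `c⁻¹ 𝒪`, so
integrating `|f̂|²` over balls that exhaust `K` averages the autocorrelation over balls that shrink
to `0`; since `μ (c 𝒪) μ (c⁻¹ 𝒪) = μ 𝒪 ^ 2`, in the limit `‖f̂‖² = μ 𝒪 ^ 2 * ‖f‖²`.

For fixed `a ≠ 0`, the function `b ↦ μ 𝒪 ^ 2 * K_ψ f (a, b)` is therefore the Fourier transform at
`-b` of `ξ ↦ |a|^{1/2} f̂ ξ * conj (ψ̂ (a ξ))`. A second use of Plancherel's theorem, now in `b`,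
followed by Tonelli's theorem and the substitution `η = ξ a`, under which `da / |a|` is invariant,
gives `‖K_ψ f‖² = c_ψ ‖f‖²`, and polarization gives the inner products. The factors `μ 𝒪` cancel,
so `μ` need not be self-dual.
-/

namespace LocalFieldCWT

section Ball

open scoped Pointwise

variable {K : Type*} [Field K] [ValuativeRel K]

/-- The fractional ideal `c 𝒪[K] = {x | |x| ≤ |c|}`, as an additive subgroup. These are the balls
around the origin over which characters and Fourier transforms are integrated. -/
noncomputable def ball (c : K) : AddSubgroup K := (valuation K).leAddSubgroup (valuation K c)

lemma mem_ball {c x : K} : x ∈ ball c ↔ valuation K x ≤ valuation K c := Iff.rfl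

lemma coe_ball (c : K) : (ball c : Set K) = {x | valuation K x ≤ valuation K c} := rfl

lemma mul_mem_ball_iff {a c x : K} (ha : a ≠ 0) : a * x ∈ ball c ↔ x ∈ ball (a⁻¹ * c) := by
  have : 0 < valuation K a := by simpa [zero_lt_iff] using ha
  simp only [mem_ball, map_mul, map_inv₀]
  rw [le_inv_mul_iff₀ this]

lemma mem_ball_inv_iff {c x : K} (hc : c ≠ 0) : x ∈ ball c⁻¹ ↔ c * x ∈ ball (1 : K) := by
  rw [mul_mem_ball_iff hc, mul_one]

lemma smul_ball (a : Kˣ) (c : K) : a • (ball c : Set K) = ball (a * c) := by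
  ext x
  rw [Set.mem_smul_set_iff_inv_smul_mem, Units.smul_def, smul_eq_mul, SetLike.mem_coe,
    mul_mem_ball_iff (by simp)]
  simp

variable [TopologicalSpace K] [IsNonarchimedeanLocalField K]

lemma isCompact_ball (c : K) : IsCompact (ball c : Set K) := by
  rw [coe_ball]
  exact IsNonarchimedeanLocalField.isCompact_closedBall K _

lemma isClosed_ball (c : K) : IsClosed (ball c : Set K) := by
  have := Valuation.isClosed_closedBall (v := valuation K) ((valuation K).restrict c)
  simpa only [coe_ball, Valuation.restrict_le_iff] using this

lemma isOpen_ball {c : K} (hc : c ≠ 0) : IsOpen (ball c : Set K) := by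
  have := Valuation.isOpen_closedBall (v := valuation K) (r := (valuation K).restrict c) (by simpa)
  simpa only [coe_ball, Valuation.restrict_le_iff] using this

lemma ball_mem_nhds_zero {c : K} (hc : c ≠ 0) : (ball c : Set K) ∈ 𝓝 0 :=
  (isOpen_ball hc).mem_nhds (zero_mem _)

lemma tendsto_ball_smallSets : Tendsto (fun c : K => (ball c : Set K)) (𝓝 0) (𝓝 0).smallSets := by
  refine tendsto_smallSets_iff.2 fun U hU => ?_
  obtain ⟨γ, hγ, hU⟩ := (IsValuativeTopology.hasBasis_nhds_zero' K).mem_iff.1 hU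
  filter_upwards [(IsValuativeTopology.hasBasis_nhds_zero' K).mem_of_mem hγ] with c hc x hx
  exact hU (lt_of_le_of_lt hx hc)

lemma eventually_mem_ball_inv (x : K) : ∀ᶠ c in 𝓝[≠] 0, x ∈ ball c⁻¹ := by
  have hx : Tendsto (· * x) (𝓝 0) (𝓝 0) := by
    simpa only [zero_mul] using (continuous_mul_const x).tendsto 0
  filter_upwards [self_mem_nhdsWithin,
    nhdsWithin_le_nhds (hx.eventually (ball_mem_nhds_zero one_ne_zero))] with c hc hcx
  exact (mem_ball_inv_iff hc).2 hcx

variable (K) in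
lemma exists_seq_tendsto_nhdsNE_zero : ∃ c : ℕ → K, Tendsto c atTop (𝓝[≠] 0) := by
  obtain ⟨t, ht, ht1⟩ := Valuation.IsNontrivial.exists_lt_one (v := valuation K)
  refine ⟨fun n => t ^ n, tendsto_nhdsWithin_iff.2 ⟨?_, .of_forall fun n => ?_⟩⟩
  · refine (IsValuativeTopology.hasBasis_nhds_zero' K).tendsto_right_iff.2 fun γ hγ => ?_
    obtain ⟨n, hn⟩ := exists_pow_lt₀ ht1 (Units.mk0 γ hγ)
    filter_upwards [eventually_ge_atTop n] with m hm
    simp only [map_pow]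
    exact (pow_le_pow_right_of_le_one' ht1.le hm).trans_lt hn
  · exact pow_ne_zero n (by simpa using ht)

instance nhdsNE_zero_neBot : (𝓝[≠] (0 : K)).NeBot :=
  let ⟨_, hc⟩ := exists_seq_tendsto_nhdsNE_zero K
  hc.neBot

instance t1Space : T1Space K := by
  refine IsTopologicalAddGroup.t1Space K ?_
  convert isClosed_ball (0 : K) using 1
  ext; simp [mem_ball]

instance sigmaCompactSpace : SigmaCompactSpace K := by
  obtain ⟨c, hc⟩ := exists_seq_tendsto_nhdsNE_zero K
  exact ⟨⟨fun n => ball (c n)⁻¹, fun n => isCompact_ball _,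
    Set.eq_univ_of_forall fun x =>
      Set.mem_iUnion.2 (hc.eventually (eventually_mem_ball_inv x)).exists⟩⟩

instance isCountablyGenerated_nhds_zero : (𝓝 (0 : K)).IsCountablyGenerated := by
  obtain ⟨c, hc⟩ := exists_seq_tendsto_nhdsNE_zero K
  obtain ⟨hc0, hc⟩ := tendsto_nhdsWithin_iff.1 hc
  obtain ⟨N, hN⟩ := eventually_atTop.1 hc
  refine HasCountableBasis.isCountablyGenerated (p := fun n => N ≤ n)
    (s := fun n => (ball (c n) : Set K)) ⟨⟨fun U => ⟨fun hU => ?_, ?_⟩⟩, Set.to_countable _⟩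
  · have hsub := (tendsto_ball_smallSets.comp hc0).eventually (eventually_smallSets_subset.2 hU)
    exact ((eventually_ge_atTop N).and hsub).exists
  · rintro ⟨n, hn, hU⟩
    exact mem_of_superset (ball_mem_nhds_zero (hN n hn)) hU

instance secondCountableTopology : SecondCountableTopology K := by
  let := IsTopologicalAddGroup.rightUniformSpace K
  have := isUniformAddGroup_of_addCommGroup (G := K)
  have : (uniformity K).IsCountablyGenerated := IsUniformAddGroup.uniformity_countably_generated
  let := TopologicalSpace.pseudoMetrizableSpacePseudoMetric K
  exact EMetric.secondCountable_of_sigmaCompact K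

end Ball

section AbsoluteValue

open scoped Pointwise

variable {K : Type*} [Field K] [ValuativeRel K] [TopologicalSpace K]
  [IsNonarchimedeanLocalField K]

lemma absK_zero : absK (0 : K) = 0 := by simp [absK]

lemma absK_of_ne_zero {a : K} (ha : a ≠ 0) : absK a = distribHaarChar K (Units.mk0 a ha) := by
  simp [absK, ha]

lemma absK_pos {a : K} (ha : a ≠ 0) : 0 < absK a := by
  rw [absK_of_ne_zero ha]; exact distribHaarChar_pos

lemma coe_absK_ne_zero {a : K} (ha : a ≠ 0) : (absK a : ℝ≥0∞) ≠ 0 :=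
  ENNReal.coe_ne_zero.2 (absK_pos ha).ne'

lemma absK_mul (a b : K) : absK (a * b) = absK a * absK b := by
  rcases eq_or_ne a 0 with rfl | ha
  · simp [absK_zero]
  rcases eq_or_ne b 0 with rfl | hb
  · simp [absK_zero]
  rw [absK_of_ne_zero ha, absK_of_ne_zero hb, absK_of_ne_zero (mul_ne_zero ha hb), ← map_mul,
    Units.mk0_mul]

lemma absK_inv (a : K) : absK a⁻¹ = (absK a)⁻¹ := by
  rcases eq_or_ne a 0 with rfl | ha
  · simp [absK_zero]
  rw [absK_of_ne_zero ha, absK_of_ne_zero (inv_ne_zero ha), ← map_inv]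
  congr 1
  ext; simp

variable [MeasurableSpace K] (μ : Measure K) [μ.IsAddHaarMeasure]

lemma measure_ball_ne_top (c : K) : μ (ball c) ≠ ∞ := (isCompact_ball c).measure_ne_top

lemma measure_ball_ne_zero {c : K} (hc : c ≠ 0) : μ (ball c) ≠ 0 :=
  ((isOpen_ball hc).measure_pos μ ⟨0, zero_mem _⟩).ne'

variable [BorelSpace K]

instance nullSingletonClass : NullSingletonClass μ :=
  Measure.IsAddHaarMeasure.nullSingletonClass μ

lemma measure_ball {c : K} (hc : c ≠ 0) : μ (ball c) = absK c * μ (ball (1 : K)) := by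
  rw [absK_of_ne_zero hc, distribHaarChar_mul, smul_ball, Units.val_mk0, mul_one]

lemma measureReal_ball_mul_inv {c : K} (hc : c ≠ 0) :
    μ.real (ball c) * μ.real (ball c⁻¹) = μ.real (ball (1 : K)) ^ 2 := by
  have : (absK c : ℝ) ≠ 0 := by exact_mod_cast (absK_pos hc).ne'
  simp only [Measure.real, measure_ball μ hc, measure_ball μ (inv_ne_zero hc), absK_inv,
    ENNReal.toReal_mul, ENNReal.coe_toReal, NNReal.coe_inv]
  field_simp

lemma absK_eq_of_valuation_eq {x y : K} (h : valuation K x = valuation K y) : absK x = absK y := by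
  rcases eq_or_ne y 0 with rfl | hy
  · rw [(valuation K).zero_iff.1 (h.trans (map_zero _))]
  have hx : x ≠ 0 := (valuation K).ne_zero_iff.1 (h ▸ (valuation K).ne_zero_iff.2 hy)
  let μ : Measure K := Measure.addHaar
  have hball : ball x = ball y := by ext; rw [mem_ball, mem_ball, h]
  rw [← ENNReal.coe_inj, ← ENNReal.mul_left_inj (measure_ball_ne_zero μ (one_ne_zero (α := K)))
    (measure_ball_ne_top μ 1), ← measure_ball μ hx, ← measure_ball μ hy, hball]

lemma measurable_absK : Measurable (absK : K → ℝ≥0) := by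
  refine measurable_of_continuousOn_compl_singleton 0 fun x hx => ContinuousAt.continuousWithinAt ?_
  refine continuousAt_const.congr (f := fun _ => absK x) ?_
  filter_upwards [(valuation K).locally_const ((valuation K).ne_zero_iff.2 hx)] with y hy
  exact absK_eq_of_valuation_eq (Eq.symm hy)

lemma map_mul_left_eq_smul {a : K} (ha : a ≠ 0) : μ.map (a * ·) = (absK a)⁻¹ • μ := by
  ext s hs
  have hpre : (a * ·) ⁻¹' s = (Units.mk0 a ha)⁻¹ • s := by
    ext x
    rw [Set.mem_smul_set_iff_inv_smul_mem]
    simp [Units.smul_def]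
  rw [Measure.map_apply (measurable_const_mul a) hs, hpre, ← distribHaarChar_mul, map_inv,
    ← absK_of_ne_zero ha]
  rfl

lemma lintegral_comp_mul_left {a : K} (ha : a ≠ 0) (f : K → ℝ≥0∞) :
    ∫⁻ x, f (a * x) ∂μ = (absK a : ℝ≥0∞)⁻¹ * ∫⁻ x, f x ∂μ := by
  have := lintegral_map_equiv (μ := μ) f (MeasurableEquiv.mulLeft₀ a ha)
  rw [MeasurableEquiv.coe_mulLeft₀, map_mul_left_eq_smul μ ha, lintegral_smul_measure] at this
  rw [← this, ENNReal.smul_def, ENNReal.coe_inv (absK_pos ha).ne', smul_eq_mul]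

lemma integral_comp_mul_left {E : Type*} [NormedAddCommGroup E] [NormedSpace ℝ E] {a : K}
    (ha : a ≠ 0) (f : K → E) : ∫ x, f (a * x) ∂μ = (absK a)⁻¹ • ∫ x, f x ∂μ := by
  have := integral_map_equiv (μ := μ) (MeasurableEquiv.mulLeft₀ a ha) f
  rw [MeasurableEquiv.coe_mulLeft₀, map_mul_left_eq_smul μ ha, integral_smul_nnreal_measure] at this
  exact this.symm

lemma lintegral_comp_mul_div_absK {ξ : K} (hξ : ξ ≠ 0) (f : K → ℝ≥0∞) :
    ∫⁻ a, f (ξ * a) / (absK a : ℝ≥0∞) ∂μ = ∫⁻ η, f η / (absK η : ℝ≥0∞) ∂μ := by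
  have h0 := coe_absK_ne_zero hξ
  have h := lintegral_comp_mul_left μ hξ fun η => f η / (absK η : ℝ≥0∞)
  rw [← ENNReal.mul_inv_cancel_left h0 ENNReal.coe_ne_top
      (b := ∫⁻ η, f η / (absK η : ℝ≥0∞) ∂μ), ← h, ← lintegral_const_mul' _ _ ENNReal.coe_ne_top]
  refine lintegral_congr fun a => ?_
  rw [absK_mul, ENNReal.coe_mul, ENNReal.div_eq_inv_mul, ENNReal.div_eq_inv_mul,
    ENNReal.mul_inv (.inl h0) (.inl ENNReal.coe_ne_top), mul_assoc,
    ENNReal.mul_inv_cancel_left h0 ENNReal.coe_ne_top]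

variable {μ}

lemma quasiMeasurePreserving_mul_left {a : K} (ha : a ≠ 0) :
    Measure.QuasiMeasurePreserving (a * ·) μ μ := by
  refine ⟨measurable_const_mul a, ?_⟩
  rw [map_mul_left_eq_smul μ ha]
  exact Measure.smul_absolutelyContinuous

lemma quasiMeasurePreserving_sub_div {a : K} (ha : a ≠ 0) (b : K) :
    Measure.QuasiMeasurePreserving (fun x => (x - b) / a) μ μ := by
  simpa only [Function.comp_def, div_eq_inv_mul] using
    (quasiMeasurePreserving_mul_left (inv_ne_zero ha)).comp
      (measurePreserving_sub_right μ b).quasiMeasurePreserving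

end AbsoluteValue

section Character

lemma setIntegral_addChar_eq_zero {G : Type*} [AddGroup G] [MeasurableSpace G] [MeasurableAdd G]
    (μ : Measure G) [μ.IsAddRightInvariant] {H : AddSubgroup G} (hH : MeasurableSet (H : Set G))
    {χ : AddChar G Circle} {w : G} (hw : w ∈ H) (hχ : χ w ≠ 1) :
    ∫ y in H, (χ y : ℂ) ∂μ = 0 := by
  have htranslate : ∫ y in H, (χ y : ℂ) ∂μ = (∫ y in H, (χ y : ℂ) ∂μ) * χ w := by
    simp only [← integral_indicator hH]
    rw [← integral_mul_const, ← integral_add_right_eq_self _ w]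
    refine integral_congr_ae (.of_forall fun y => ?_)
    by_cases hy : y ∈ H <;> simp [H.add_mem_cancel_right hw, hy, AddChar.map_add_eq_mul]
  by_contra h0
  exact hχ (Circle.ext ((mul_eq_left₀ h0).1 htranslate.symm))

variable {K : Type*} [Field K] [ValuativeRel K] [TopologicalSpace K]
  [IsNonarchimedeanLocalField K] {χ : AddChar K Circle}

lemma IsBasicCharacter.apply_mul_eq_one (hχ : IsBasicCharacter χ) {c z y : K} (hc : c ≠ 0)
    (hz : z ∈ ball c⁻¹) (hy : y ∈ ball c) : χ (z * y) = 1 := by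
  apply hχ.trivial_on_integers
  rw [Valuation.mem_integer_iff, map_mul]
  calc valuation K z * valuation K y ≤ valuation K c⁻¹ * valuation K c := mul_le_mul' hz hy
    _ = 1 := by rw [← map_mul, inv_mul_cancel₀ hc, map_one]

lemma IsBasicCharacter.exists_mem_ball_one_apply_mul_ne_one (hχ : IsBasicCharacter χ) {z : K}
    (hz : z ∉ ball (1 : K)) : ∃ y ∈ ball (1 : K), χ (z * y) ≠ 1 := by
  obtain ⟨x, hx, hx1⟩ := hχ.nontrivial_on_inverse
  have hz0 : z ≠ 0 := fun h => hz (h ▸ zero_mem _)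
  have hlt : valuation K z⁻¹ < 1 := by
    rw [mem_ball, map_one, not_le] at hz
    rw [map_inv₀]
    exact inv_lt_one_of_one_lt₀ hz
  have hmem : (⟨z⁻¹, hlt.le⟩ : 𝒪[K]) ∈ 𝓂[K] := fun hunit =>
    hlt.ne ((Valuation.integer.integers (valuation K)).isUnit_iff_valuation_eq_one.1 hunit)
  refine ⟨x * z⁻¹, ?_, by rwa [mul_comm x, mul_inv_cancel_left₀ hz0]⟩
  simpa only [mem_ball, map_one, Valuation.mem_integer_iff] using hx _ hmem

lemma IsBasicCharacter.exists_mem_ball_apply_mul_ne_one (hχ : IsBasicCharacter χ) {c z : K}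
    (hc : c ≠ 0) (hz : z ∉ ball c⁻¹) : ∃ y ∈ ball c, χ (z * y) ≠ 1 := by
  rw [mem_ball_inv_iff hc] at hz
  obtain ⟨y, hy, hy1⟩ := hχ.exists_mem_ball_one_apply_mul_ne_one hz
  refine ⟨c * y, ?_, by rwa [← mul_assoc, mul_comm z]⟩
  rwa [mul_mem_ball_iff hc, inv_mul_cancel₀ hc]

variable [MeasurableSpace K] [BorelSpace K] (μ : Measure K) [μ.IsAddHaarMeasure]

lemma IsBasicCharacter.setIntegral_ball (hχ : IsBasicCharacter χ) {c : K} (hc : c ≠ 0) (z : K) :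
    ∫ y in ball c, (χ (z * y) : ℂ) ∂μ =
      (ball c⁻¹ : Set K).indicator (fun _ => (μ.real (ball c) : ℂ)) z := by
  have hball := (isClosed_ball c).measurableSet
  by_cases hz : z ∈ ball c⁻¹
  · rw [Set.indicator_of_mem hz, setIntegral_congr_fun (g := fun _ => (1 : ℂ)) hball
      fun y hy => by simp [hχ.apply_mul_eq_one hc hz hy]]
    simp
  · rw [Set.indicator_of_notMem hz]
    obtain ⟨w, hw, hw1⟩ := hχ.exists_mem_ball_apply_mul_ne_one hc hz
    exact setIntegral_addChar_eq_zero μ hball (χ := χ.mulShift z) hw hw1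

end Character

section FourierIntegral

open scoped Convolution
open ContinuousLinearMap (mul)

variable {R : Type*} [CommRing R] [MeasurableSpace R] {χ : AddChar R Circle} {μ : Measure R}

lemma fourierIntegral_conj_comp_neg [MeasurableNeg R] [μ.IsNegInvariant] (f : R → ℂ) (ξ : R) :
    Fourier.fourierIntegral χ μ (fun x => conj (f (-x))) ξ =
      conj (Fourier.fourierIntegral χ μ f ξ) := by
  rw [Fourier.fourierIntegral_def, Fourier.fourierIntegral_def, ← integral_conj,
    ← integral_neg_eq_self]
  simp [Circle.smul_def, AddChar.map_neg_eq_inv, -Circle.coe_inv, Circle.coe_inv_eq_conj]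

variable [TopologicalSpace R] [IsTopologicalRing R] [BorelSpace R]

section

variable {E : Type*} [NormedAddCommGroup E] [NormedSpace ℂ E]

lemma continuous_fourierIntegral [FirstCountableTopology R] (hχ : Continuous χ) {f : R → E}
    (hf : Integrable f μ) : Continuous (Fourier.fourierIntegral χ μ f) :=
  VectorFourier.fourierIntegral_continuous hχ continuous_mul hf

lemma fourierIntegral_add (hχ : Continuous χ) {f g : R → E} (hf : Integrable f μ)
    (hg : Integrable g μ) : Fourier.fourierIntegral χ μ (f + g) =
      Fourier.fourierIntegral χ μ f + Fourier.fourierIntegral χ μ g :=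
  VectorFourier.fourierIntegral_add (L := LinearMap.mul R R) hχ continuous_mul hf hg

lemma fourierIntegral_sub (hχ : Continuous χ) {f g : R → E} (hf : Integrable f μ)
    (hg : Integrable g μ) : Fourier.fourierIntegral χ μ (f - g) =
      Fourier.fourierIntegral χ μ f - Fourier.fourierIntegral χ μ g := by
  rw [eq_sub_iff_add_eq, ← fourierIntegral_add hχ (hf.sub hg) hg, sub_add_cancel]

end

lemma integrable_addChar_neg_mul_mul (hχ : Continuous χ) {f : R → ℂ} (hf : Integrable f μ)
    (ξ : R) : Integrable (fun x => χ (-(x * ξ)) * f x) μ :=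
  (VectorFourier.fourierIntegral_convergent_iff (L := LinearMap.mul R R) hχ continuous_mul ξ).2 hf

variable [SecondCountableTopology R]

lemma integral_fourierIntegral_mul [SigmaFinite μ] (hχ : Continuous χ) {f g : R → ℂ}
    (hf : Integrable f μ) (hg : Integrable g μ) :
    ∫ ξ, Fourier.fourierIntegral χ μ f ξ * g ξ ∂μ =
      ∫ x, f x * Fourier.fourierIntegral χ μ g x ∂μ := by
  have := VectorFourier.integral_fourierIntegral_smul_eq_flip (μ := μ) (ν := μ)
    (L := LinearMap.mul R R) hχ continuous_mul hf hg
  rwa [LinearMap.flip_mul] at this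

lemma fourierIntegral_convolution [SFinite μ] [μ.IsAddRightInvariant] (hχ : Continuous χ)
    {f g : R → ℂ} (hf : Integrable f μ) (hg : Integrable g μ) (ξ : R) :
    Fourier.fourierIntegral χ μ (f ⋆[mul ℂ ℂ, μ] g) ξ =
      Fourier.fourierIntegral χ μ f ξ * Fourier.fourierIntegral χ μ g ξ := by
  have htwist : ∀ x, (χ (-(x * ξ)) : ℂ) * (f ⋆[mul ℂ ℂ, μ] g) x =
      ((fun y => χ (-(y * ξ)) * f y) ⋆[mul ℂ ℂ, μ] fun y => χ (-(y * ξ)) * g y) x := fun x => by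
    simp only [convolution_def, ContinuousLinearMap.mul_apply', ← integral_const_mul]
    refine integral_congr_ae (.of_forall fun y => ?_)
    have hsplit : -(x * ξ) = -(y * ξ) + -((x - y) * ξ) := by ring
    simp only [hsplit, AddChar.map_add_eq_mul, Circle.coe_mul]
    ring
  simp only [Fourier.fourierIntegral_def, Circle.smul_def, smul_eq_mul, htwist]
  exact integral_convolution (mul ℂ ℂ) (integrable_addChar_neg_mul_mul hχ hf ξ)
    (integrable_addChar_neg_mul_mul hχ hg ξ)

end FourierIntegral

section L2

variable {X Y : Type*} [MeasurableSpace X] [MeasurableSpace Y] {μ : Measure X} {ν : Measure Y}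

lemma eLpNorm_two_sq {E : Type*} [NormedAddCommGroup E] (f : X → E) :
    eLpNorm f 2 μ ^ 2 = ∫⁻ x, ‖f x‖ₑ ^ 2 ∂μ := by
  simpa using eLpNorm_nnreal_pow_eq_lintegral (f := f) (μ := μ) (p := 2) two_ne_zero

lemma toReal_eLpNorm_two_sq {E : Type*} [NormedAddCommGroup E] {f : X → E}
    (hf : AEStronglyMeasurable f μ) : (eLpNorm f 2 μ).toReal ^ 2 = ∫ x, ‖f x‖ ^ 2 ∂μ := by
  rw [← ENNReal.toReal_pow, eLpNorm_two_sq,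
    integral_eq_lintegral_of_nonneg_ae (.of_forall fun _ => sq_nonneg _) (hf.norm.pow 2)]
  simp only [ENNReal.ofReal_pow, norm_nonneg, ofReal_norm]

lemma l2Inner_eq_inner {f g : X → ℂ} (hf : MemLp f 2 μ) (hg : MemLp g 2 μ) :
    l2Inner μ f g = inner ℂ (hg.toLp g) (hf.toLp f) := by
  rw [L2.inner_def]
  refine integral_congr_ae ?_
  filter_upwards [hf.coeFn_toLp, hg.coeFn_toLp] with x hfx hgx
  rw [hfx, hgx, RCLike.inner_apply]

lemma l2Inner_eq_mul_of_eLpNorm {f g : X → ℂ} {F G : Y → ℂ} (hf : MemLp f 2 μ) (hg : MemLp g 2 μ)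
    (hF : MemLp F 2 ν) (hG : MemLp G 2 ν) (r : ℝ)
    (h : ∀ c : ℂ, (eLpNorm (G + c • F) 2 ν).toReal ^ 2 =
      r * (eLpNorm (g + c • f) 2 μ).toReal ^ 2) :
    l2Inner ν F G = r * l2Inner μ f g := by
  have hnorm (c : ℂ) : ((‖hG.toLp G + c • hF.toLp F‖ : ℝ) : ℂ) ^ 2 =
      r * ((‖hg.toLp g + c • hf.toLp f‖ : ℝ) : ℂ) ^ 2 := by
    rw [← MemLp.toLp_const_smul, ← MemLp.toLp_const_smul, ← MemLp.toLp_add, ← MemLp.toLp_add,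
      Lp.norm_toLp, Lp.norm_toLp]
    exact_mod_cast h c
  have hone := hnorm 1
  have hneg_one := hnorm (-1)
  have hI := hnorm Complex.I
  have hneg_I := hnorm (-Complex.I)
  simp only [one_smul, neg_smul, ← sub_eq_add_neg] at hone hneg_one hI hneg_I
  rw [l2Inner_eq_inner hF hG, l2Inner_eq_inner hf hg, inner_eq_sum_norm_sq_div_four,
    inner_eq_sum_norm_sq_div_four]
  simp only [RCLike.I_to_complex, Complex.coe_algebraMap]
  rw [hone, hneg_one, hI, hneg_I]
  ring

lemma exists_seq_integrable_tendsto_eLpNorm {E : Type*} [NormedAddCommGroup E] {p : ℝ≥0∞}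
    (hp0 : p ≠ 0) (hp : p ≠ ∞) {f : X → E} (hf : MemLp f p μ) :
    ∃ u : ℕ → X → E, (∀ n, Integrable (u n) μ ∧ MemLp (u n) p μ) ∧
      Tendsto (fun n => eLpNorm (u n - f) p μ) atTop (𝓝 0) := by
  have happrox (n : ℕ) : ∃ u : X → E, (Integrable u μ ∧ MemLp u p μ) ∧
      eLpNorm (u - f) p μ ≤ (n : ℝ≥0∞)⁻¹ := by
    obtain ⟨u, hu, hup⟩ := hf.exists_simpleFunc_eLpNorm_sub_lt hp
      (ENNReal.inv_ne_zero.2 (ENNReal.natCast_ne_top n))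
    exact ⟨u, ⟨(SimpleFunc.memLp_iff_integrable hp0 hp).1 hup, hup⟩,
      by rw [eLpNorm_sub_comm]; exact hu.le⟩
  choose u hu hle using happrox
  exact ⟨u, hu, tendsto_of_tendsto_of_tendsto_of_le_of_le tendsto_const_nhds
    ENNReal.tendsto_inv_nat_nhds_zero (fun _ => zero_le) hle⟩

lemma tendsto_eLpNorm_add_smul {𝕜 E : Type*} [NormedField 𝕜] [NormedAddCommGroup E]
    [NormedSpace 𝕜 E] {p : ℝ≥0∞} [Fact (1 ≤ p)] {f g : X → E} {u w : ℕ → X → E}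
    (hf : MemLp f p μ) (hg : MemLp g p μ) (hu : ∀ n, MemLp (u n) p μ) (hw : ∀ n, MemLp (w n) p μ)
    (hut : Tendsto (fun n => eLpNorm (u n - f) p μ) atTop (𝓝 0))
    (hwt : Tendsto (fun n => eLpNorm (w n - g) p μ) atTop (𝓝 0)) (c : 𝕜) :
    Tendsto (fun n => eLpNorm (u n + c • w n - (f + c • g)) p μ) atTop (𝓝 0) := by
  rw [← Lp.tendsto_Lp_iff_tendsto_eLpNorm'' _ hu _ hf] at hut
  rw [← Lp.tendsto_Lp_iff_tendsto_eLpNorm'' _ hw _ hg] at hwt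
  rw [← Lp.tendsto_Lp_iff_tendsto_eLpNorm'' _ (fun n => (hu n).add ((hw n).const_smul c)) _
    (hf.add (hg.const_smul c))]
  exact hut.add (hwt.const_smul c)

end L2

section Plancherel

open scoped Convolution
open ContinuousLinearMap (mul)

section Autocorrelation

variable {G : Type*} [AddGroup G] [MeasurableSpace G]

/-- The autocorrelation `t ↦ ∫ f(x) conj (f(x - t)) dx`, written as the convolution of `f` with
its conjugate reflection, so that its Fourier transform is `|f̂|²`. -/
noncomputable def autocorrelation (μ : Measure G) (f : G → ℂ) : G → ℂ :=
  f ⋆[mul ℂ ℂ, μ] fun x => conj (f (-x))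

variable {μ : Measure G}

lemma autocorrelation_apply (f : G → ℂ) (t : G) :
    autocorrelation μ f t = ∫ x, f x * conj (f (x - t)) ∂μ := by
  simp only [autocorrelation, convolution_def, ContinuousLinearMap.mul_apply', neg_sub]

lemma autocorrelation_zero (f : G → ℂ) :
    autocorrelation μ f 0 = ((∫ x, ‖f x‖ ^ 2 ∂μ : ℝ) : ℂ) := by
  simp only [autocorrelation_apply, sub_zero, Complex.mul_conj, Complex.normSq_eq_norm_sq,
    integral_complex_ofReal]

lemma integrable_conj_comp_neg [MeasurableNeg G] [μ.IsNegInvariant] {f : G → ℂ}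
    (hf : Integrable f μ) : Integrable (fun x => conj (f (-x))) μ :=
  Complex.conjCLE.toContinuousLinearMap.integrable_comp hf.comp_neg

lemma integrable_autocorrelation [MeasurableAdd₂ G] [MeasurableNeg G] [SFinite μ]
    [μ.IsAddRightInvariant] [μ.IsNegInvariant] {f : G → ℂ} (hf : Integrable f μ) :
    Integrable (autocorrelation μ f) μ :=
  hf.integrable_convolution _ (integrable_conj_comp_neg hf)

end Autocorrelation

lemma continuous_autocorrelation {G : Type*} [AddCommGroup G] [TopologicalSpace G]
    [IsTopologicalAddGroup G] [LocallyCompactSpace G] [SecondCountableTopology G]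
    [MeasurableSpace G] [BorelSpace G] {μ : Measure G} [μ.IsAddHaarMeasure] {f : G → ℂ}
    (hf : MemLp f 2 μ) :
    Continuous (autocorrelation μ f) := by
  have hinner : autocorrelation μ f = fun t : G =>
      inner ℂ (DomAddAct.mk (-t) +ᵥ hf.toLp f) (hf.toLp f) := by
    ext t
    rw [autocorrelation_apply, L2.inner_def]
    refine integral_congr_ae ?_
    have htranslate : ∀ᵐ x ∂μ, hf.toLp f (-t + x) = f (-t + x) :=
      (measurePreserving_add_left μ (-t)).quasiMeasurePreserving.ae hf.coeFn_toLp
    filter_upwards [DomAddAct.vadd_Lp_ae_eq (DomAddAct.mk (-t)) (hf.toLp f), htranslate,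
      hf.coeFn_toLp] with x hvadd htranslate hx
    rw [hvadd, hx]
    simp [htranslate, sub_eq_neg_add]
  have : Fact ((2 : ℝ≥0∞) ≠ ∞) := ⟨ENNReal.ofNat_ne_top⟩
  rw [hinner]
  exact ((DomAddAct.continuous_mk.comp continuous_neg).vadd continuous_const).inner continuous_const

lemma fourierIntegral_autocorrelation {R : Type*} [CommRing R] [TopologicalSpace R]
    [IsTopologicalRing R] [SecondCountableTopology R] [MeasurableSpace R] [BorelSpace R]
    {μ : Measure R} [SFinite μ] [μ.IsAddRightInvariant] [μ.IsNegInvariant] {χ : AddChar R Circle}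
    (hχ : Continuous χ) {f : R → ℂ} (hf : Integrable f μ) (ξ : R) :
    Fourier.fourierIntegral χ μ (autocorrelation μ f) ξ =
      ((‖Fourier.fourierIntegral χ μ f ξ‖ ^ 2 : ℝ) : ℂ) := by
  rw [autocorrelation, fourierIntegral_convolution hχ hf (integrable_conj_comp_neg hf),
    fourierIntegral_conj_comp_neg, Complex.mul_conj, Complex.normSq_eq_norm_sq]

variable {K : Type*} [Field K] [ValuativeRel K] [TopologicalSpace K]
  [IsNonarchimedeanLocalField K] [MeasurableSpace K] [BorelSpace K]
  {μ : Measure K}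

lemma aecover_ball_inv : AECover μ (𝓝[≠] 0) fun c : K => (ball c⁻¹ : Set K) :=
  ⟨.of_forall eventually_mem_ball_inv, fun _ => (isClosed_ball _).measurableSet⟩

variable {χ : AddChar K Circle} [μ.IsAddHaarMeasure]

lemma setIntegral_ball_fourierIntegral (hχ : IsBasicCharacter χ) {g : K → ℂ}
    (hg : Integrable g μ) {c : K} (hc : c ≠ 0) :
    ∫ ξ in ball c, Fourier.fourierIntegral χ μ g ξ ∂μ =
      μ.real (ball c) * ∫ x in ball c⁻¹, g x ∂μ := by
  have hball := (isClosed_ball c).measurableSet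
  have hball' := (isClosed_ball c⁻¹).measurableSet
  have hind : Integrable ((ball c : Set K).indicator fun _ => (1 : ℂ)) μ :=
    (integrable_indicator_iff hball).2 (integrableOn_const (measure_ball_ne_top μ c))
  have hindhat : ∀ x, Fourier.fourierIntegral χ μ ((ball c : Set K).indicator fun _ => (1 : ℂ)) x =
      (ball c⁻¹ : Set K).indicator (fun _ => (μ.real (ball c) : ℂ)) x := fun x => by
    rw [← hχ.setIntegral_ball μ hc, ← integral_indicator hball, Fourier.fourierIntegral_def,
      ← integral_neg_eq_self]
    refine integral_congr_ae (.of_forall fun ξ => ?_)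
    by_cases hξ : ξ ∈ ball c <;> simp [hξ, Circle.smul_def, mul_comm]
  calc ∫ ξ in ball c, Fourier.fourierIntegral χ μ g ξ ∂μ
      = ∫ ξ, Fourier.fourierIntegral χ μ g ξ * (ball c : Set K).indicator (fun _ => 1) ξ ∂μ := by
        rw [← integral_indicator hball]
        simp only [← Set.indicator_mul_right, mul_one]
    _ = ∫ x, g x * (ball c⁻¹ : Set K).indicator (fun _ => (μ.real (ball c) : ℂ)) x ∂μ := by
        rw [integral_fourierIntegral_mul hχ.continuous hg hind]
        simp only [hindhat]
    _ = μ.real (ball c) * ∫ x in ball c⁻¹, g x ∂μ := by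
        simp only [← Set.indicator_mul_right, integral_indicator hball', integral_mul_const]
        exact mul_comm _ _

lemma tendsto_setIntegral_ball_inv_fourierIntegral (hχ : IsBasicCharacter χ) {g : K → ℂ}
    (hg : Integrable g μ) (hg0 : ContinuousAt g 0) :
    Tendsto (fun c : K => ∫ ξ in ball c⁻¹, Fourier.fourierIntegral χ μ g ξ ∂μ) (𝓝[≠] 0)
      (𝓝 ((μ.real (ball (1 : K)) ^ 2 : ℝ) * g 0)) := by
  have ho : (fun c : K => (∫ x in ball c, g x ∂μ) - μ.real (ball c) • g 0) =o[𝓝[≠] 0]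
      fun c => μ.real (ball c) :=
    hg0.integral_sub_linear_isLittleO_ae hg.aestronglyMeasurable.stronglyMeasurableAtFilter
      (tendsto_ball_smallSets.mono_left nhdsWithin_le_nhds)
  have hscaled := (Asymptotics.isBigO_refl (fun c : K => μ.real (ball c⁻¹)) _).smul_isLittleO ho
  rw [← tendsto_sub_nhds_zero_iff, ← Asymptotics.isLittleO_one_iff ℝ]
  refine (hscaled.congr' ?_ ?_).trans_isBigO
    (Asymptotics.isBigO_const_const (μ.real (ball (1 : K)) ^ 2) one_ne_zero _)
  all_goals
    filter_upwards [self_mem_nhdsWithin] with c hc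
    have hmeas := measureReal_ball_mul_inv μ (inv_ne_zero hc)
    rw [inv_inv] at hmeas
  · rw [setIntegral_ball_fourierIntegral hχ hg (inv_ne_zero hc), inv_inv, ← hmeas, smul_sub,
      smul_smul, Complex.real_smul, Complex.real_smul]
  · exact hmeas

lemma integrable_sq_norm_fourierIntegral_and_integral (hχ : IsBasicCharacter χ) {f : K → ℂ}
    (hf : Integrable f μ) (hf2 : MemLp f 2 μ) :
    Integrable (fun ξ => ‖Fourier.fourierIntegral χ μ f ξ‖ ^ 2) μ ∧
    ∫ ξ, ‖Fourier.fourierIntegral χ μ f ξ‖ ^ 2 ∂μ =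
      μ.real (ball (1 : K)) ^ 2 * ∫ x, ‖f x‖ ^ 2 ∂μ := by
  have hcont := (continuous_fourierIntegral hχ.continuous hf).norm.pow 2
  have hlim : Tendsto (fun c : K => ∫ ξ in ball c⁻¹, ‖Fourier.fourierIntegral χ μ f ξ‖ ^ 2 ∂μ)
      (𝓝[≠] 0) (𝓝 (μ.real (ball (1 : K)) ^ 2 * ∫ x, ‖f x‖ ^ 2 ∂μ)) := by
    have := (Complex.continuous_re.tendsto _).comp
      (tendsto_setIntegral_ball_inv_fourierIntegral hχ (integrable_autocorrelation hf)
        (continuous_autocorrelation hf2).continuousAt)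
    simpa only [fourierIntegral_autocorrelation hχ.continuous hf, autocorrelation_zero,
      integral_complex_ofReal, Function.comp_def, ← Complex.ofReal_mul, Complex.ofReal_re]
      using this
  have hint := aecover_ball_inv.integrable_of_integral_tendsto_of_nonneg_ae _
    (fun _ => hcont.continuousOn.integrableOn_compact (isCompact_ball _))
    (.of_forall fun _ => sq_nonneg _) hlim
  exact ⟨hint,
    tendsto_nhds_unique (aecover_ball_inv.integral_tendsto_of_countably_generated hint) hlim⟩

lemma memLp_fourierIntegral (hχ : IsBasicCharacter χ) {f : K → ℂ} (hf : Integrable f μ)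
    (hf2 : MemLp f 2 μ) : MemLp (Fourier.fourierIntegral χ μ f) 2 μ :=
  (memLp_two_iff_integrable_sq_norm
    (continuous_fourierIntegral hχ.continuous hf).aestronglyMeasurable).2
    (integrable_sq_norm_fourierIntegral_and_integral hχ hf hf2).1

lemma eLpNorm_fourierIntegral (hχ : IsBasicCharacter χ) {f : K → ℂ} (hf : Integrable f μ)
    (hf2 : MemLp f 2 μ) :
    eLpNorm (Fourier.fourierIntegral χ μ f) 2 μ = μ (ball (1 : K)) * eLpNorm f 2 μ := by
  have hsq : (eLpNorm (Fourier.fourierIntegral χ μ f) 2 μ).toReal ^ 2 =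
      (μ (ball (1 : K)) * eLpNorm f 2 μ).toReal ^ 2 := by
    rw [toReal_eLpNorm_two_sq (memLp_fourierIntegral hχ hf hf2).1,
      (integrable_sq_norm_fourierIntegral_and_integral hχ hf hf2).2, ENNReal.toReal_mul, mul_pow,
      toReal_eLpNorm_two_sq hf2.1, Measure.real]
  rwa [sq_eq_sq₀ ENNReal.toReal_nonneg ENNReal.toReal_nonneg, ENNReal.toReal_eq_toReal_iff'
    (memLp_fourierIntegral hχ hf hf2).eLpNorm_ne_top
    (ENNReal.mul_ne_top (measure_ball_ne_top μ 1) hf2.eLpNorm_ne_top)] at hsq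

end Plancherel

section L2Fourier

lemma IsL2Fourier.congr_ae {K : Type*} [Field K] [MeasurableSpace K] {χ : AddChar K Circle}
    {μ : Measure K} {f F F' : K → ℂ} (h : IsL2Fourier χ μ f F) (hF : F =ᵐ[μ] F') :
    IsL2Fourier χ μ f F' := by
  obtain ⟨hF2, u, hu, hut, huF⟩ := h
  refine ⟨hF2.ae_eq hF, u, hu, hut, ?_⟩
  simpa only [eLpNorm_congr_ae (EventuallyEq.rfl.sub hF)] using huF

variable {K : Type*} [Field K] [ValuativeRel K] [TopologicalSpace K]
  [IsNonarchimedeanLocalField K] [MeasurableSpace K] [BorelSpace K]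
  {χ : AddChar K Circle} {μ : Measure K} [μ.IsAddHaarMeasure]

lemma IsL2Fourier.add_smul (hχ : IsBasicCharacter χ) {f g F G : K → ℂ} (hf : MemLp f 2 μ)
    (hg : MemLp g 2 μ) (hfF : IsL2Fourier χ μ f F) (hgG : IsL2Fourier χ μ g G) (c : ℂ) :
    IsL2Fourier χ μ (f + c • g) (F + c • G) := by
  obtain ⟨hF, u, hu, hut, huF⟩ := hfF
  obtain ⟨hG, w, hw, hwt, hwG⟩ := hgG
  refine ⟨hF.add (hG.const_smul c), fun n => u n + c • w n,
    fun n => ⟨(hu n).1.add ((hw n).1.smul c), (hu n).2.add ((hw n).2.const_smul c)⟩,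
    tendsto_eLpNorm_add_smul hf hg (fun n => (hu n).2) (fun n => (hw n).2) hut hwt c, ?_⟩
  have hlin (n : ℕ) : Fourier.fourierIntegral χ μ (u n + c • w n) =
      Fourier.fourierIntegral χ μ (u n) + c • Fourier.fourierIntegral χ μ (w n) := by
    rw [fourierIntegral_add hχ.continuous (hu n).1 ((hw n).1.smul c),
      Fourier.fourierIntegral_const_smul]
  simp only [hlin]
  exact tendsto_eLpNorm_add_smul hF hG (fun n => memLp_fourierIntegral hχ (hu n).1 (hu n).2)
    (fun n => memLp_fourierIntegral hχ (hw n).1 (hw n).2) huF hwG c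

lemma IsL2Fourier.eLpNorm_eq (hχ : IsBasicCharacter χ) {f F : K → ℂ} (hf : MemLp f 2 μ)
    (h : IsL2Fourier χ μ f F) : eLpNorm F 2 μ = μ (ball (1 : K)) * eLpNorm f 2 μ := by
  obtain ⟨hF, u, hu, hut, huF⟩ := h
  have hû (n : ℕ) := memLp_fourierIntegral hχ (hu n).1 (hu n).2
  rw [← Lp.tendsto_Lp_iff_tendsto_eLpNorm'' _ (fun n => (hu n).2) _ hf] at hut
  rw [← Lp.tendsto_Lp_iff_tendsto_eLpNorm'' _ hû _ hF] at huF
  have hnorm (n : ℕ) : ‖(hû n).toLp‖ₑ = μ (ball (1 : K)) * ‖(hu n).2.toLp‖ₑ := by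
    rw [Lp.enorm_toLp, Lp.enorm_toLp, eLpNorm_fourierIntegral hχ (hu n).1 (hu n).2]
  rw [← Lp.enorm_toLp hF, ← Lp.enorm_toLp hf]
  refine tendsto_nhds_unique huF.enorm ?_
  simp only [hnorm]
  exact ENNReal.Tendsto.const_mul hut.enorm (.inr (measure_ball_ne_top μ 1))

lemma IsL2Fourier.l2Inner_eq (hχ : IsBasicCharacter χ) {f g F G : K → ℂ} (hf : MemLp f 2 μ)
    (hg : MemLp g 2 μ) (hfF : IsL2Fourier χ μ f F) (hgG : IsL2Fourier χ μ g G) :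
    l2Inner μ F G = (μ.real (ball (1 : K)) ^ 2 : ℝ) * l2Inner μ f g := by
  refine l2Inner_eq_mul_of_eLpNorm hf hg hfF.1 hgG.1 _ fun c => ?_
  rw [(hgG.add_smul hχ hg hf hfF c).eLpNorm_eq hχ (hg.add (hf.const_smul c)), ENNReal.toReal_mul,
    mul_pow, Measure.real]

lemma IsL2Fourier.ae_unique (hχ : IsBasicCharacter χ) {f F F' : K → ℂ} (hf : MemLp f 2 μ)
    (h : IsL2Fourier χ μ f F) (h' : IsL2Fourier χ μ f F') : F =ᵐ[μ] F' := by
  have hsub := (h.add_smul hχ hf hf h' (-1)).eLpNorm_eq hχ (hf.add (hf.const_smul (-1)))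
  simp only [neg_smul, one_smul, ← sub_eq_add_neg, sub_self, eLpNorm_zero, mul_zero] at hsub
  exact (sub_ae_eq_zero _ _).1 ((eLpNorm_eq_zero_iff (h.1.sub h'.1).1 two_ne_zero).1 hsub)

lemma dist_toLp_fourierIntegral (hχ : IsBasicCharacter χ) {f g : K → ℂ}
    (hf : Integrable f μ) (hf2 : MemLp f 2 μ) (hg : Integrable g μ) (hg2 : MemLp g 2 μ) :
    dist (memLp_fourierIntegral hχ hf hf2).toLp (memLp_fourierIntegral hχ hg hg2).toLp =
      μ.real (ball (1 : K)) * dist hf2.toLp hg2.toLp := by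
  rw [dist_edist, dist_edist, Lp.edist_toLp_toLp, Lp.edist_toLp_toLp,
    ← fourierIntegral_sub hχ.continuous hf hg,
    eLpNorm_fourierIntegral hχ (hf.sub hg) (hf2.sub hg2), ENNReal.toReal_mul, Measure.real]

lemma exists_isL2Fourier (hχ : IsBasicCharacter χ) {f : K → ℂ} (hf : MemLp f 2 μ) :
    ∃ F, IsL2Fourier χ μ f F := by
  obtain ⟨u, hu, hut⟩ := exists_seq_integrable_tendsto_eLpNorm two_ne_zero ENNReal.ofNat_ne_top hf
  have hû (n : ℕ) := memLp_fourierIntegral hχ (hu n).1 (hu n).2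
  have hcauchy : CauchySeq fun n => (hu n).2.toLp :=
    ((Lp.tendsto_Lp_iff_tendsto_eLpNorm'' _ (fun n => (hu n).2) _ hf).2 hut).cauchySeq
  have hcauchy' : CauchySeq fun n => (hû n).toLp := by
    rw [cauchySeq_iff_tendsto_dist_atTop_0] at hcauchy ⊢
    simp only [fun n m => dist_toLp_fourierIntegral hχ (hu n).1 (hu n).2 (hu m).1 (hu m).2]
    simpa only [mul_zero] using hcauchy.const_mul (μ.real (ball (1 : K)))
  obtain ⟨F, hF⟩ := cauchySeq_tendsto_of_complete hcauchy'
  refine ⟨F, Lp.memLp F, u, hu, hut, ?_⟩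
  rwa [← Lp.tendsto_Lp_iff_tendsto_eLpNorm'' _ hû _ (Lp.memLp F), Lp.toLp_coeFn]

lemma exists_measurable_isL2Fourier (hχ : IsBasicCharacter χ) {f : K → ℂ} (hf : MemLp f 2 μ) :
    ∃ F, Measurable F ∧ IsL2Fourier χ μ f F := by
  obtain ⟨F, hF⟩ := exists_isL2Fourier hχ hf
  exact ⟨_, hF.1.1.stronglyMeasurable_mk.measurable, hF.congr_ae hF.1.1.ae_eq_mk⟩

lemma isL2Fourier_fourierL2 (hχ : IsBasicCharacter χ) {f : K → ℂ} (hf : MemLp f 2 μ) :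
    IsL2Fourier χ μ f (fourierL2 χ μ f) :=
  Classical.epsilon_spec (exists_isL2Fourier hχ hf)

lemma admissibilityConst_eq_lintegral (hχ : IsBasicCharacter χ) {ψ Ψ : K → ℂ} (hψ : MemLp ψ 2 μ)
    (hΨ : IsL2Fourier χ μ ψ Ψ) :
    admissibilityConst χ μ ψ = ∫⁻ ξ, ‖Ψ ξ‖ₑ ^ 2 / (absK ξ : ℝ≥0∞) ∂μ := by
  refine lintegral_congr_ae ?_
  filter_upwards [(isL2Fourier_fourierL2 hχ hψ).ae_unique hχ hψ hΨ] with ξ hξ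
  rw [hξ]

end L2Fourier

section Daughter

variable {K : Type*} [Field K] [ValuativeRel K] [TopologicalSpace K]
  [IsNonarchimedeanLocalField K]

lemma daughter_zero (f : K → ℂ) (b : K) : daughter f 0 b = 0 := by
  ext x
  simp only [daughter, absK_zero, NNReal.coe_zero, Real.sqrt_zero, inv_zero, Complex.ofReal_zero,
    zero_mul, Pi.zero_apply]

lemma daughter_sub (f g : K → ℂ) (a b : K) :
    daughter (f - g) a b = daughter f a b - daughter g a b :=
  funext fun _ => mul_sub _ _ _

lemma daughter_inv_zero_apply (f : K → ℂ) (a x : K) :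
    daughter f a⁻¹ 0 x = (Real.sqrt (absK a) : ℂ) * f (a * x) := by
  rw [daughter, absK_inv, NNReal.coe_inv, Real.sqrt_inv, inv_inv, sub_zero, div_inv_eq_mul,
    mul_comm x]

lemma enorm_sq_daughter (f : K → ℂ) (a b x : K) :
    ‖daughter f a b x‖ₑ ^ 2 = ((absK a)⁻¹ : ℝ≥0) * ‖f ((x - b) / a)‖ₑ ^ 2 := by
  rw [daughter, enorm_mul, mul_pow, ← Real.sqrt_inv, ← NNReal.coe_inv, ← ofReal_norm (_ : ℂ),
    Complex.norm_real, Real.norm_of_nonneg (Real.sqrt_nonneg _),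
    ← ENNReal.ofReal_pow (Real.sqrt_nonneg _), Real.sq_sqrt (NNReal.coe_nonneg _),
    ENNReal.ofReal_coe_nnreal]

lemma inv_absK_sq_mul_enorm_sq_mul_conj_daughter {a : K} (ha : a ≠ 0) (Ψ : K → ℂ) (z : ℂ)
    (ξ : K) : ((absK a ^ 2)⁻¹ : ℝ≥0) * ‖z * conj (daughter Ψ a⁻¹ 0 ξ)‖ₑ ^ 2 =
      ‖z‖ₑ ^ 2 * (‖Ψ (ξ * a)‖ₑ ^ 2 / (absK a : ℝ≥0∞)) := by
  have hweight : (((absK a ^ 2)⁻¹ : ℝ≥0) : ℝ≥0∞) * absK a = (absK a : ℝ≥0∞)⁻¹ := by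
    rw [← ENNReal.coe_mul, ← ENNReal.coe_inv (absK_pos ha).ne', sq, mul_inv, mul_assoc,
      inv_mul_cancel₀ (absK_pos ha).ne', mul_one]
  rw [enorm_mul, mul_pow, RCLike.enorm_conj, enorm_sq_daughter, absK_inv, inv_inv, sub_zero,
    div_inv_eq_mul, mul_left_comm, ← mul_assoc (((absK a ^ 2)⁻¹ : ℝ≥0) : ℝ≥0∞), hweight,
    ENNReal.div_eq_inv_mul]

variable [MeasurableSpace K] [BorelSpace K]

lemma measurable_daughter {f : K → ℂ} (hf : Measurable f) :
    Measurable fun q : (K × K) × K => daughter f q.1.1 q.1.2 q.2 :=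
  (measurable_absK.comp measurable_fst.fst).coe_nnreal_real.sqrt.inv.complex_ofReal.mul
    (hf.comp ((measurable_snd.sub measurable_fst.snd).div measurable_fst.fst))

variable {χ : AddChar K Circle} {μ : Measure K} [μ.IsAddHaarMeasure]

lemma eLpNorm_daughter {a : K} (ha : a ≠ 0) (b : K) (f : K → ℂ) :
    eLpNorm (daughter f a b) 2 μ = eLpNorm f 2 μ := by
  refine (ENNReal.pow_right_strictMono two_ne_zero).injective ?_
  simp only [eLpNorm_two_sq, enorm_sq_daughter, div_eq_inv_mul]
  rw [lintegral_const_mul' _ _ ENNReal.coe_ne_top,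
    lintegral_sub_right_eq_self (fun x => ‖f (a⁻¹ * x)‖ₑ ^ 2) b,
    lintegral_comp_mul_left μ (inv_ne_zero ha) (fun x => ‖f x‖ₑ ^ 2), absK_inv,
    ENNReal.mul_inv_cancel_left (absK_inv a ▸ coe_absK_ne_zero (inv_ne_zero ha))
      ENNReal.coe_ne_top]

lemma memLp_daughter {f : K → ℂ} (hf : MemLp f 2 μ) (a b : K) : MemLp (daughter f a b) 2 μ := by
  rcases eq_or_ne a 0 with rfl | ha
  · rw [daughter_zero]
    exact MemLp.zero
  · exact ⟨(hf.1.comp_quasiMeasurePreserving (quasiMeasurePreserving_sub_div ha b)).const_mul _,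
      (eLpNorm_daughter ha b f).trans_lt hf.2⟩

lemma integrable_daughter {f : K → ℂ} (hf : Integrable f μ) {a : K} (ha : a ≠ 0) (b : K) :
    Integrable (daughter f a b) μ := by
  have hdilate : Integrable (fun x => f (x / a)) μ := by
    have hmap := hf.smul_measure_nnreal (c := (absK a⁻¹)⁻¹)
    rw [← map_mul_left_eq_smul μ (inv_ne_zero ha)] at hmap
    simpa only [Function.comp_def, div_eq_inv_mul] using
      hmap.comp_measurable (measurable_const_mul _)
  exact (hdilate.comp_sub_right b).const_mul _

lemma fourierIntegral_daughter {a : K} (ha : a ≠ 0) (b : K) (f : K → ℂ) :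
    Fourier.fourierIntegral χ μ (daughter f a b) =
      fun ξ => χ (-(b * ξ)) • daughter (Fourier.fourierIntegral χ μ f) a⁻¹ 0 ξ := by
  ext ξ
  have hsqrt : ((absK a : ℝ) : ℂ) = (Real.sqrt (absK a) : ℂ) * Real.sqrt (absK a) := by
    rw [← Complex.ofReal_mul, Real.mul_self_sqrt (NNReal.coe_nonneg _)]
  have hne : (Real.sqrt (absK a) : ℂ) ≠ 0 :=
    Complex.ofReal_ne_zero.2 (Real.sqrt_ne_zero'.2 (NNReal.coe_pos.2 (absK_pos ha)))
  have hsplit (x : K) : χ (-((x + b) * ξ)) • (((Real.sqrt (absK a))⁻¹ : ℝ) * f (x / a)) =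
      (((Real.sqrt (absK a))⁻¹ : ℝ) : ℂ) * χ (-(b * ξ)) *
        (χ (-(a⁻¹ * x * (a * ξ))) • f (a⁻¹ * x)) := by
    have harg : -((x + b) * ξ) = -(b * ξ) + -(a⁻¹ * x * (a * ξ)) := by field_simp; ring
    rw [harg, AddChar.map_add_eq_mul, Circle.smul_def, Circle.smul_def, Circle.coe_mul,
      div_eq_inv_mul, smul_eq_mul, smul_eq_mul]
    ring
  rw [Fourier.fourierIntegral_def, daughter_inv_zero_apply, Fourier.fourierIntegral_def]
  calc ∫ x, χ (-(x * ξ)) • daughter f a b x ∂μ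
      = ∫ x, χ (-((x + b) * ξ)) • (((Real.sqrt (absK a))⁻¹ : ℝ) * f (x / a)) ∂μ := by
        rw [← integral_add_right_eq_self _ b]
        simp only [daughter, add_sub_cancel_right]
    _ = ((Real.sqrt (absK a))⁻¹ : ℝ) * χ (-(b * ξ)) *
        (absK a • ∫ x, χ (-(x * (a * ξ))) • f x ∂μ) := by
        simp only [hsplit]
        rw [integral_const_mul, integral_comp_mul_left μ (inv_ne_zero ha)
          (fun x => χ (-(x * (a * ξ))) • f x), absK_inv, inv_inv]
    _ = χ (-(b * ξ)) • (Real.sqrt (absK a) * ∫ x, χ (-(x * (a * ξ))) • f x ∂μ) := by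
        rw [NNReal.smul_def, Complex.real_smul, Circle.smul_def, smul_eq_mul, hsqrt,
          Complex.ofReal_inv]
        linear_combination (χ (-(b * ξ)) * Real.sqrt (absK a) *
          ∫ x, χ (-(x * (a * ξ))) • f x ∂μ) * inv_mul_cancel₀ hne

lemma eLpNorm_addChar_smul_daughter {a : K} (ha : a ≠ 0) (b : K) (F : K → ℂ) :
    eLpNorm (fun ξ => χ (-(b * ξ)) • daughter F a 0 ξ) 2 μ = eLpNorm F 2 μ := by
  rw [← eLpNorm_daughter ha 0 F]
  exact eLpNorm_congr_norm_ae (.of_forall fun ξ => Circle.norm_smul _ _)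

lemma isL2Fourier_daughter (hχ : Continuous χ) {ψ Ψ : K → ℂ}
    (h : IsL2Fourier χ μ ψ Ψ) {a : K} (ha : a ≠ 0) (b : K) :
    IsL2Fourier χ μ (daughter ψ a b) (fun ξ => χ (-(b * ξ)) • daughter Ψ a⁻¹ 0 ξ) := by
  obtain ⟨hΨ, u, hu, hut, huΨ⟩ := h
  have hcont : Continuous fun ξ : K => χ (-(b * ξ)) :=
    hχ.comp (continuous_const.mul continuous_id).neg
  refine ⟨⟨?_, (eLpNorm_addChar_smul_daughter (inv_ne_zero ha) b Ψ).trans_lt hΨ.2⟩,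
    fun n => daughter (u n) a b,
    fun n => ⟨integrable_daughter (hu n).1 ha b, memLp_daughter (hu n).2 a b⟩, ?_, ?_⟩
  · exact hcont.aestronglyMeasurable.smul (memLp_daughter hΨ a⁻¹ 0).1
  · simpa only [← daughter_sub, eLpNorm_daughter ha] using hut
  · have hsub (n : ℕ) : Fourier.fourierIntegral χ μ (daughter (u n) a b) -
        (fun ξ => χ (-(b * ξ)) • daughter Ψ a⁻¹ 0 ξ) = fun ξ => χ (-(b * ξ)) •
          daughter (Fourier.fourierIntegral χ μ (u n) - Ψ) a⁻¹ 0 ξ := by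
      rw [fourierIntegral_daughter ha, daughter_sub]
      exact funext fun ξ => (smul_sub _ _ _).symm
    simpa only [hsub, eLpNorm_addChar_smul_daughter (inv_ne_zero ha)] using huΨ

end Daughter

section WaveletTransform

variable {K : Type*} [Field K] [ValuativeRel K] [TopologicalSpace K]
  [IsNonarchimedeanLocalField K] [MeasurableSpace K] [BorelSpace K] {μ : Measure K}

lemma lintegral_cwtMeasure [SFinite μ] {F : K × K → ℝ≥0∞} (hF : Measurable F) :
    ∫⁻ p, F p ∂cwtMeasure μ =
      ∫⁻ a, ((absK a ^ 2)⁻¹ : ℝ≥0) * ∫⁻ b, F (a, b) ∂μ ∂μ := by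
  have hweight : Measurable fun p : K × K => (((absK p.1 ^ 2)⁻¹ : ℝ≥0) : ℝ≥0∞) :=
    ((measurable_absK.comp measurable_fst).pow_const 2).inv.coe_nnreal_ennreal
  rw [cwtMeasure, lintegral_withDensity_eq_lintegral_mul _ hweight hF,
    lintegral_prod _ (hweight.mul hF).aemeasurable]
  simp only [Pi.mul_apply, lintegral_const_mul' _ _ ENNReal.coe_ne_top]

variable {χ : AddChar K Circle} [μ.IsAddHaarMeasure]

lemma cwt_congr_ae {ψ ψ' f f' : K → ℂ} (hψ : ψ =ᵐ[μ] ψ') (hf : f =ᵐ[μ] f') :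
    cwt μ ψ f = cwt μ ψ' f' := by
  ext ⟨a, b⟩
  rcases eq_or_ne a 0 with rfl | ha
  · simp only [cwt, daughter_zero]
    exact integral_congr_ae (hf.mul .rfl)
  · refine integral_congr_ae ?_
    filter_upwards [hf, (quasiMeasurePreserving_sub_div ha b).ae_eq hψ] with x hfx hψx
    simp only [Function.comp_apply] at hψx
    rw [hfx, daughter, daughter, hψx]

lemma stronglyMeasurable_cwt {ψ f : K → ℂ} (hψ : AEStronglyMeasurable ψ μ)
    (hf : AEStronglyMeasurable f μ) : StronglyMeasurable (cwt μ ψ f) := by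
  rw [cwt_congr_ae hψ.ae_eq_mk hf.ae_eq_mk]
  have hintegrand := (hf.stronglyMeasurable_mk.measurable.comp measurable_snd).mul
    (Complex.continuous_conj.measurable.comp
      (measurable_daughter hψ.stronglyMeasurable_mk.measurable))
  exact hintegrand.stronglyMeasurable.integral_prod_right

lemma cwt_add_smul {ψ f g : K → ℂ} (hψ : MemLp ψ 2 μ) (hf : MemLp f 2 μ) (hg : MemLp g 2 μ)
    (c : ℂ) : cwt μ ψ (g + c • f) = cwt μ ψ g + c • cwt μ ψ f := by
  ext ⟨a, b⟩
  have hconj : MemLp (fun x => conj (daughter ψ a b x)) 2 μ := (memLp_daughter hψ a b).star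
  simp only [cwt, Pi.add_apply, Pi.smul_apply, smul_eq_mul, ← integral_const_mul]
  simp only [add_mul, mul_assoc]
  exact integral_add (hg.integrable_mul hconj) ((hf.integrable_mul hconj).const_mul c)

lemma cwt_eq_fourierIntegral (hχ : IsBasicCharacter χ) {ψ Ψ f Φ : K → ℂ} (hψ : MemLp ψ 2 μ)
    (hf : MemLp f 2 μ) (hΨ : IsL2Fourier χ μ ψ Ψ) (hΦ : IsL2Fourier χ μ f Φ) {a : K}
    (ha : a ≠ 0) (b : K) :
    (μ.real (ball (1 : K)) ^ 2 : ℝ) * cwt μ ψ f (a, b) =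
      Fourier.fourierIntegral χ μ (fun ξ => Φ ξ * conj (daughter Ψ a⁻¹ 0 ξ)) (-b) := by
  refine (hΦ.l2Inner_eq hχ hf (memLp_daughter hψ a b)
    (isL2Fourier_daughter hχ.continuous hΨ ha b)).symm.trans ?_
  rw [l2Inner, Fourier.fourierIntegral_def]
  refine integral_congr_ae (.of_forall fun ξ => ?_)
  have hconj : conj (χ (-(b * ξ)) : ℂ) = χ (-(ξ * -b)) := by
    rw [← Circle.coe_inv_eq_conj, ← AddChar.map_neg_eq_inv, mul_neg, mul_comm ξ]
  simp only [Circle.smul_def, smul_eq_mul, map_mul, hconj]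
  ring

lemma lintegral_enorm_sq_cwt (hχ : IsBasicCharacter χ) {ψ Ψ f Φ : K → ℂ} (hψ : MemLp ψ 2 μ)
    (hf : MemLp f 2 μ) (hΨ : IsL2Fourier χ μ ψ Ψ) (hΦ : IsL2Fourier χ μ f Φ) {a : K} (ha : a ≠ 0)
    (h2 : MemLp (fun ξ => Φ ξ * conj (daughter Ψ a⁻¹ 0 ξ)) 2 μ) :
    μ (ball (1 : K)) ^ 2 * ∫⁻ b, ‖cwt μ ψ f (a, b)‖ₑ ^ 2 ∂μ =
      ∫⁻ ξ, ‖Φ ξ * conj (daughter Ψ a⁻¹ 0 ξ)‖ₑ ^ 2 ∂μ := by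
  have h1 : Integrable (fun ξ => Φ ξ * conj (daughter Ψ a⁻¹ 0 ξ)) μ :=
    hΦ.1.integrable_mul (memLp_daughter hΨ.1 a⁻¹ 0).star
  have hball0 := pow_ne_zero 2 (measure_ball_ne_zero μ (one_ne_zero (α := K)))
  have hball := ENNReal.pow_ne_top (n := 2) (measure_ball_ne_top μ (1 : K))
  have hconst : ‖((μ.real (ball (1 : K)) ^ 2 : ℝ) : ℂ)‖ₑ = μ (ball (1 : K)) ^ 2 := by
    rw [← ofReal_norm, Complex.norm_real, Real.norm_of_nonneg (sq_nonneg _),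
      ENNReal.ofReal_pow measureReal_nonneg, Measure.real,
      ENNReal.ofReal_toReal (measure_ball_ne_top μ 1)]
  rw [← ENNReal.mul_right_inj hball0 hball]
  calc μ (ball (1 : K)) ^ 2 * (μ (ball (1 : K)) ^ 2 * ∫⁻ b, ‖cwt μ ψ f (a, b)‖ₑ ^ 2 ∂μ)
      = ∫⁻ b, ‖(μ.real (ball (1 : K)) ^ 2 : ℝ) * cwt μ ψ f (a, b)‖ₑ ^ 2 ∂μ := by
        simp only [enorm_mul, mul_pow _ _ 2, hconst]
        rw [lintegral_const_mul' _ _ (ENNReal.pow_ne_top hball), sq (μ _ ^ 2), mul_assoc]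
    _ = eLpNorm (Fourier.fourierIntegral χ μ fun ξ => Φ ξ * conj (daughter Ψ a⁻¹ 0 ξ)) 2 μ ^ 2 := by
        simp only [cwt_eq_fourierIntegral hχ hψ hf hΨ hΦ ha]
        rw [lintegral_neg_eq_self (μ := μ) (fun b => ‖Fourier.fourierIntegral χ μ _ b‖ₑ ^ 2),
          eLpNorm_two_sq]
    _ = μ (ball (1 : K)) ^ 2 * ∫⁻ ξ, ‖Φ ξ * conj (daughter Ψ a⁻¹ 0 ξ)‖ₑ ^ 2 ∂μ := by
        rw [eLpNorm_fourierIntegral hχ h1 h2, mul_pow, eLpNorm_two_sq]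

lemma measurable_mul_conj_daughter {Ψ Φ : K → ℂ} (hΨ : Measurable Ψ) (hΦ : Measurable Φ) :
    Measurable fun p : K × K => Φ p.2 * conj (daughter Ψ p.1⁻¹ 0 p.2) := by
  have hpair : Measurable fun p : K × K => ((p.1⁻¹, (0 : K)), p.2) := by fun_prop
  exact (hΦ.comp measurable_snd).mul (Complex.continuous_conj.measurable.comp
    ((measurable_daughter hΨ).comp hpair))

lemma lintegral_lintegral_mul_conj_daughter {Ψ Φ : K → ℂ} (hΨ : Measurable Ψ)
    (hΦ : Measurable Φ) :
    ∫⁻ a, ((absK a ^ 2)⁻¹ : ℝ≥0) * ∫⁻ ξ, ‖Φ ξ * conj (daughter Ψ a⁻¹ 0 ξ)‖ₑ ^ 2 ∂μ ∂μ =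
      (∫⁻ η, ‖Ψ η‖ₑ ^ 2 / (absK η : ℝ≥0∞) ∂μ) * ∫⁻ ξ, ‖Φ ξ‖ₑ ^ 2 ∂μ := by
  have hmeas : Measurable fun p : K × K =>
      ‖Φ p.2‖ₑ ^ 2 * (‖Ψ (p.2 * p.1)‖ₑ ^ 2 / (absK p.1 : ℝ≥0∞)) :=
    ((hΦ.comp measurable_snd).enorm.pow_const 2).mul
      (((hΨ.comp (measurable_snd.mul measurable_fst)).enorm.pow_const 2).div
        (measurable_absK.comp measurable_fst).coe_nnreal_ennreal)
  calc ∫⁻ a, ((absK a ^ 2)⁻¹ : ℝ≥0) * ∫⁻ ξ, ‖Φ ξ * conj (daughter Ψ a⁻¹ 0 ξ)‖ₑ ^ 2 ∂μ ∂μ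
      = ∫⁻ a, ∫⁻ ξ, ‖Φ ξ‖ₑ ^ 2 * (‖Ψ (ξ * a)‖ₑ ^ 2 / (absK a : ℝ≥0∞)) ∂μ ∂μ := by
        simp only [← lintegral_const_mul' _ _ ENNReal.coe_ne_top]
        exact lintegral_congr_ae ((Measure.ae_ne μ 0).mono fun a ha =>
          lintegral_congr fun ξ => inv_absK_sq_mul_enorm_sq_mul_conj_daughter ha Ψ (Φ ξ) ξ)
    _ = ∫⁻ ξ, ∫⁻ a, ‖Φ ξ‖ₑ ^ 2 * (‖Ψ (ξ * a)‖ₑ ^ 2 / (absK a : ℝ≥0∞)) ∂μ ∂μ :=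
        lintegral_lintegral_swap hmeas.aemeasurable
    _ = ∫⁻ ξ, (∫⁻ η, ‖Ψ η‖ₑ ^ 2 / (absK η : ℝ≥0∞) ∂μ) * ‖Φ ξ‖ₑ ^ 2 ∂μ := by
        refine lintegral_congr_ae ((Measure.ae_ne μ 0).mono fun ξ hξ => ?_)
        simp only
        rw [lintegral_const_mul' _ _ (ENNReal.pow_ne_top enorm_ne_top),
          lintegral_comp_mul_div_absK μ hξ fun η => ‖Ψ η‖ₑ ^ 2, mul_comm]
    _ = _ := lintegral_const_mul _ (hΦ.enorm.pow_const 2)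

lemma ae_memLp_mul_conj_daughter {Ψ Φ : K → ℂ} (hΨ : Measurable Ψ) (hΦ : Measurable Φ)
    (hΨfin : ∫⁻ η, ‖Ψ η‖ₑ ^ 2 / (absK η : ℝ≥0∞) ∂μ < ∞) (hΦ2 : MemLp Φ 2 μ) :
    ∀ᵐ a ∂μ, MemLp (fun ξ => Φ ξ * conj (daughter Ψ a⁻¹ 0 ξ)) 2 μ := by
  have htotal : ∫⁻ a, ((absK a ^ 2)⁻¹ : ℝ≥0) *
      ∫⁻ ξ, ‖Φ ξ * conj (daughter Ψ a⁻¹ 0 ξ)‖ₑ ^ 2 ∂μ ∂μ < ∞ := by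
    rw [lintegral_lintegral_mul_conj_daughter hΨ hΦ, ← eLpNorm_two_sq]
    exact ENNReal.mul_lt_top hΨfin (ENNReal.pow_lt_top hΦ2.2)
  have hmeas : Measurable fun a : K => ((absK a ^ 2)⁻¹ : ℝ≥0) *
      ∫⁻ ξ, ‖Φ ξ * conj (daughter Ψ a⁻¹ 0 ξ)‖ₑ ^ 2 ∂μ :=
    (measurable_absK.pow_const 2).inv.coe_nnreal_ennreal.mul
      ((measurable_mul_conj_daughter hΨ hΦ).enorm.pow_const 2).lintegral_prod_right
  filter_upwards [ae_lt_top hmeas htotal.ne, Measure.ae_ne μ 0] with a hlt ha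
  have hweight : (((absK a ^ 2)⁻¹ : ℝ≥0) : ℝ≥0∞) ≠ 0 :=
    ENNReal.coe_ne_zero.2 (inv_ne_zero (pow_ne_zero 2 (absK_pos ha).ne'))
  have hfin := ENNReal.lt_top_of_mul_ne_top_right hlt.ne hweight
  rw [← eLpNorm_two_sq] at hfin
  exact ⟨((measurable_mul_conj_daughter hΨ hΦ).comp measurable_prodMk_left).aestronglyMeasurable,
    (ENNReal.pow_lt_top_iff.1 hfin).resolve_right two_ne_zero⟩

lemma eLpNorm_cwt_sq (hχ : IsBasicCharacter χ) {ψ f : K → ℂ} (hψ : IsAdmissible χ μ ψ)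
    (hf : MemLp f 2 μ) : eLpNorm (cwt μ ψ f) 2 (cwtMeasure μ) ^ 2 =
      admissibilityConst χ μ ψ * eLpNorm f 2 μ ^ 2 := by
  obtain ⟨Ψ, hΨm, hΨ⟩ := exists_measurable_isL2Fourier hχ hψ.1
  obtain ⟨Φ, hΦm, hΦ⟩ := exists_measurable_isL2Fourier hχ hf
  have hc := admissibilityConst_eq_lintegral hχ hψ.1 hΨ
  have hball := ENNReal.pow_ne_top (n := 2) (measure_ball_ne_top μ (1 : K))
  have hmem := ae_memLp_mul_conj_daughter hΨm hΦm (hc ▸ hψ.2) hΦ.1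
  rw [← ENNReal.mul_right_inj
    (pow_ne_zero 2 (measure_ball_ne_zero μ (one_ne_zero (α := K)))) hball]
  calc μ (ball (1 : K)) ^ 2 * eLpNorm (cwt μ ψ f) 2 (cwtMeasure μ) ^ 2
      = ∫⁻ a, ((absK a ^ 2)⁻¹ : ℝ≥0) *
          (μ (ball (1 : K)) ^ 2 * ∫⁻ b, ‖cwt μ ψ f (a, b)‖ₑ ^ 2 ∂μ) ∂μ := by
        rw [eLpNorm_two_sq, lintegral_cwtMeasure
          ((stronglyMeasurable_cwt hψ.1.1 hf.1).measurable.enorm.pow_const 2),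
          ← lintegral_const_mul' _ _ hball]
        simp only [mul_left_comm]
    _ = ∫⁻ a, ((absK a ^ 2)⁻¹ : ℝ≥0) *
          ∫⁻ ξ, ‖Φ ξ * conj (daughter Ψ a⁻¹ 0 ξ)‖ₑ ^ 2 ∂μ ∂μ := by
        refine lintegral_congr_ae ?_
        filter_upwards [hmem, Measure.ae_ne μ 0] with a h2 ha
        rw [lintegral_enorm_sq_cwt hχ hψ.1 hf hΨ hΦ ha h2]
    _ = admissibilityConst χ μ ψ * eLpNorm Φ 2 μ ^ 2 := by
        rw [lintegral_lintegral_mul_conj_daughter hΨm hΦm, ← hc, eLpNorm_two_sq]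
    _ = μ (ball (1 : K)) ^ 2 * (admissibilityConst χ μ ψ * eLpNorm f 2 μ ^ 2) := by
        rw [hΦ.eLpNorm_eq hχ hf, mul_pow, mul_left_comm]

lemma memLp_cwt (hχ : IsBasicCharacter χ) {ψ f : K → ℂ} (hψ : IsAdmissible χ μ ψ)
    (hf : MemLp f 2 μ) : MemLp (cwt μ ψ f) 2 (cwtMeasure μ) := by
  have hsq : eLpNorm (cwt μ ψ f) 2 (cwtMeasure μ) ^ 2 < ∞ := by
    rw [eLpNorm_cwt_sq hχ hψ hf]
    exact ENNReal.mul_lt_top hψ.2 (ENNReal.pow_lt_top hf.2)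
  exact ⟨(stronglyMeasurable_cwt hψ.1.1 hf.1).aestronglyMeasurable,
    (ENNReal.pow_lt_top_iff.1 hsq).resolve_right two_ne_zero⟩

end WaveletTransform

end LocalFieldCWT

theorem mainTheorem1 {K : Type*} [Field K] [ValuativeRel K] [TopologicalSpace K]
    [IsNonarchimedeanLocalField K] [MeasurableSpace K] [BorelSpace K]
    (μ : Measure K) [μ.IsAddHaarMeasure]
    (χ : AddChar K Circle) (hχ : LocalFieldCWT.IsBasicCharacter χ)
    (ψ : K → ℂ) (hψ : LocalFieldCWT.IsAdmissible χ μ ψ)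
    (f g : K → ℂ) (hf : MemLp f 2 μ) (hg : MemLp g 2 μ) :
    MemLp (LocalFieldCWT.cwt μ ψ f) 2 (LocalFieldCWT.cwtMeasure μ) ∧
    MemLp (LocalFieldCWT.cwt μ ψ g) 2 (LocalFieldCWT.cwtMeasure μ) ∧
    LocalFieldCWT.l2Inner (LocalFieldCWT.cwtMeasure μ)
        (LocalFieldCWT.cwt μ ψ f) (LocalFieldCWT.cwt μ ψ g) =
      ((LocalFieldCWT.admissibilityConst χ μ ψ).toReal : ℂ) * LocalFieldCWT.l2Inner μ f g ∧
    eLpNorm (LocalFieldCWT.cwt μ ψ f) 2 (LocalFieldCWT.cwtMeasure μ) ^ 2 =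
      LocalFieldCWT.admissibilityConst χ μ ψ * eLpNorm f 2 μ ^ 2 := by
  have hKf := LocalFieldCWT.memLp_cwt hχ hψ hf
  have hKg := LocalFieldCWT.memLp_cwt hχ hψ hg
  refine ⟨hKf, hKg, LocalFieldCWT.l2Inner_eq_mul_of_eLpNorm hf hg hKf hKg _ fun c => ?_,
    LocalFieldCWT.eLpNorm_cwt_sq hχ hψ hf⟩
  rw [← LocalFieldCWT.cwt_add_smul hψ.1 hf hg, ← ENNReal.toReal_pow,
    LocalFieldCWT.eLpNorm_cwt_sq hχ hψ (hg.add (hf.const_smul c)), ENNReal.toReal_mul,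
    ENNReal.toReal_pow]
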